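/- Let $k,m\in\mathbb{N}$, let $\mathcal{M}_k$ be the algebra of complex $k\times k$ matrices, and identify $\mathcal{M}_k\otimes\mathcal{M}_m$ with $\mathcal{M}_{km}$ via the Kronecker product. A \emph{state} is a positive semidefinite Hermitian matrix $\gamma\in\mathcal{M}_k\otimes\mathcal{M}_m$ (not necessarily normalized). For $\gamma=\sum_{i=1}^n A_i\otimes B_i$ put $\gamma^{\Gamma}=\sum_{i=1}^n A_i\otimes B_i^t$ and define the linear maps $G_\gamma:\mathcal{M}_k\to\mathcal{M}_m$, $G_\gamma(X)=\sum_{i=1}^n \mathrm{tr}(A_iX)B_i$, and $F_\gamma:\mathcal{M}_m\to\mathcal{M}_k$, $F_\gamma(Y)=\sum_{i=1}^n \mathrm{tr}(B_iY)A_i$. A linear map $T:\mathcal{M}_k\to\mathcal{M}_k$ that is positive (it maps positive semidefinite matrices to positive semidefinite matrices) and self-adjoint with respect to the trace inner product ($\mathrm{tr}(T(X)Y^*)=\mathrm{tr}(XT(Y)^*)$ for all $X,Y$) is called \emph{completely reducible} if there are an integer $l\ge 0$ and orthogonal projections $W_1,\dots,W_l\in\mathcal{M}_k$ with $W_iW_j=0$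 for $i\neq j$ such that $$\mathcal{M}_k=\bigoplus_{i=1}^l W_i\mathcal{M}_kW_i\oplus R,$$ where $R$ is the orthogonal complement of $\bigoplus_{i=1}^l W_i\mathcal{M}_kW_i$ with respect to the trace inner product $\mathrm{tr}(XY^*)$; $T(W_i\mathcal{M}_kW_i)\subset W_i\mathcal{M}_kW_i$ for every $i$; $T|_{W_i\mathcal{M}_kW_i}$ is irreducible for every $i$, i.e. if $W\in\mathcal{M}_k$ is an orthogonal projection with $W\mathcal{M}_kW\subset W_i\mathcal{M}_kW_i$ and $T(W\mathcal{M}_kW)\subset W\mathcal{M}_kW$, then $W=0$ or $W=W_i$; and $T|_R\equiv 0$. Let $$CR_{k,m}=\{\gamma\in\mathcal{M}_k\otimes\mathcal{M}_m:\ \gamma\ge 0 \text{ and } F_\gamma\circ G_\gamma:\mathcal{M}_k\to\mathcal{M}_k \text{ is completely reducible}\}.$$ If $\gamma\in\mathcal{M}_k\otimes\mathcal{M}_m$ satisfies $\gamma\ge 0$ and $\gamma^{\Gamma}\ge 0$, then $\gamma\in CR_{k,m}$. In particular, $F_\gamma\circ G_\gamma$ is a positive map that is self-adjoint with respect to the trace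 inner product. -/

import Mathlib

open scoped Kronecker ComplexOrder

namespace CompletelyReducible

/-- `M k` is the algebra of complex `k × k` matrices. -/
abbrev M (k : ℕ) : Type := Matrix (Fin k) (Fin k) ℂ

/-- `M k ⊗ M m`, identified through the Kronecker product with the matrices whose rows and columns
are indexed by `Fin k × Fin m`. -/
abbrev M₂ (k m : ℕ) : Type := Matrix (Fin k × Fin m) (Fin k × Fin m) ℂ

/-- Partial transpose on the second factor: `∑ᵢ Aᵢ ⊗ Bᵢ ↦ ∑ᵢ Aᵢ ⊗ Bᵢᵀ`. -/
def partialTranspose {k m : ℕ} (γ : M₂ k m) : M₂ k m :=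
  Matrix.of fun p q => γ (p.1, q.2) (q.1, p.2)

/-- `G_γ(X) = ∑ᵢ tr(Aᵢ X) Bᵢ` for `γ = ∑ᵢ Aᵢ ⊗ Bᵢ`, written in coordinates. -/
def mapG {k m : ℕ} (γ : M₂ k m) : M k →ₗ[ℂ] M m where
  toFun X := Matrix.of fun j j' => ∑ a, ∑ a', γ (a, j) (a', j') * X a' a
  map_add' X Y := by
    ext j j'
    simp [mul_add, Finset.sum_add_distrib]
  map_smul' c X := by
    ext j j'
    simp [Finset.mul_sum, mul_left_comm]

/-- `F_γ(Y) = ∑ᵢ tr(Bᵢ Y) Aᵢ` for `γ = ∑ᵢ Aᵢ ⊗ Bᵢ`, written in coordinates. -/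
def mapF {k m : ℕ} (γ : M₂ k m) : M m →ₗ[ℂ] M k where
  toFun Y := Matrix.of fun a a' => ∑ j, ∑ j', γ (a, j) (a', j') * Y j' j
  map_add' X Y := by
    ext a a'
    simp [mul_add, Finset.sum_add_distrib]
  map_smul' c X := by
    ext a a'
    simp [Finset.mul_sum, mul_left_comm]

/-- The coordinate formula is the partial transpose on sums of Kronecker products. -/
theorem partialTranspose_sum_kronecker {k m n : ℕ} (A : Fin n → M k) (B : Fin n → M m) :
    partialTranspose (∑ i, A i ⊗ₖ B i) = ∑ i, A i ⊗ₖ (B i).transpose := by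
  ext p q
  simp [partialTranspose, Matrix.sum_apply]

/-- The coordinate formula is `G_γ` on sums of Kronecker products. -/
theorem mapG_sum_kronecker {k m n : ℕ} (A : Fin n → M k) (B : Fin n → M m) (X : M k) :
    mapG (∑ i, A i ⊗ₖ B i) X = ∑ i, (A i * X).trace • B i := by
  ext j j'
  simp only [mapG, LinearMap.coe_mk, AddHom.coe_mk, Matrix.of_apply, Matrix.sum_apply,
    Matrix.kroneckerMap_apply, Matrix.smul_apply, smul_eq_mul, Matrix.trace, Matrix.diag_apply,
    Matrix.mul_apply, Finset.sum_mul]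
  rw [Finset.sum_comm]
  simp_rw [Finset.sum_comm (s := (Finset.univ : Finset (Fin k))) (t := (Finset.univ : Finset (Fin n)))]
  refine Finset.sum_congr rfl fun i _ => ?_
  rw [Finset.sum_comm]
  exact Finset.sum_congr rfl fun _ _ => Finset.sum_congr rfl fun _ _ => by ring

/-- The coordinate formula is `F_γ` on sums of Kronecker products. -/
theorem mapF_sum_kronecker {k m n : ℕ} (A : Fin n → M k) (B : Fin n → M m) (Y : M m) :
    mapF (∑ i, A i ⊗ₖ B i) Y = ∑ i, (B i * Y).trace • A i := by
  ext j j'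
  simp only [mapF, LinearMap.coe_mk, AddHom.coe_mk, Matrix.of_apply, Matrix.sum_apply,
    Matrix.kroneckerMap_apply, Matrix.smul_apply, smul_eq_mul, Matrix.trace, Matrix.diag_apply,
    Matrix.mul_apply, Finset.sum_mul]
  rw [Finset.sum_comm]
  simp_rw [Finset.sum_comm (s := (Finset.univ : Finset (Fin m))) (t := (Finset.univ : Finset (Fin n)))]
  refine Finset.sum_congr rfl fun i _ => ?_
  rw [Finset.sum_comm]
  exact Finset.sum_congr rfl fun _ _ => Finset.sum_congr rfl fun _ _ => by ring

/-- The subspace `W M_k W = {W X W | X ∈ M_k}` of `M_k`. -/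
def corner {k : ℕ} (W : M k) : Submodule ℂ (M k) :=
  LinearMap.range (LinearMap.mulLeftRight ℂ (W, W))

theorem mem_corner {k : ℕ} (W Y : M k) : Y ∈ corner W ↔ ∃ X : M k, W * X * W = Y := by
  simp [corner, LinearMap.mulLeftRight_apply]

/-- `T` leaves `W M_k W` invariant. -/
def LeavesInvariant {k : ℕ} (T : M k →ₗ[ℂ] M k) (W : M k) : Prop :=
  ∀ X ∈ corner W, T X ∈ corner W

/-- Positive maps send positive semidefinite matrices to positive semidefinite matrices. -/
def IsPositiveMap {k : ℕ} (T : M k →ₗ[ℂ] M k) : Prop :=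
  ∀ X : M k, X.PosSemidef → (T X).PosSemidef

/-- Self-adjointness with respect to the trace inner product `tr(X Y*)`. -/
def IsSelfAdjointMap {k : ℕ} (T : M k →ₗ[ℂ] M k) : Prop :=
  ∀ X Y : M k, (T X * Y.conjTranspose).trace = (X * (T Y).conjTranspose).trace

/-- Irreducibility of the restriction of `T` to `V M_k V` (for `T` leaving `V M_k V` invariant):
the only sub-algebras `W M_k W ⊆ V M_k V`, `W` an orthogonal projection, which `T` leaves
invariant are those with `W = 0` or `W = V`. -/
def IsIrreducibleOn {k : ℕ} (T : M k →ₗ[ℂ] M k) (V : M k) : Prop :=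
  ∀ W : M k, IsStarProjection W → corner W ≤ corner V → LeavesInvariant T W → W = 0 ∨ W = V

/-- The orthogonal complement in `M_k` of a subspace, for the trace inner product `tr(X Y*)`. -/
def traceOrthogonal {k : ℕ} (S : Submodule ℂ (M k)) : Submodule ℂ (M k) where
  carrier := {X | ∀ Y ∈ S, (X * Y.conjTranspose).trace = 0}
  add_mem' hX hX' Y hY := by
    rw [add_mul, Matrix.trace_add, hX Y hY, hX' Y hY, add_zero]
  zero_mem' Y _ := by simp
  smul_mem' c X hX Y hY := by
    rw [smul_mul_assoc, Matrix.trace_smul, hX Y hY, smul_zero]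

/-- A self-adjoint positive map `T : M_k → M_k` is completely reducible if
`M_k = ⨁ᵢ Wᵢ M_k Wᵢ ⊕ R` for mutually orthogonal orthogonal projections `W₁, …, W_l`, with `R` the
orthogonal complement of `⨁ᵢ Wᵢ M_k Wᵢ`, such that `T` leaves every `Wᵢ M_k Wᵢ` invariant, is
irreducible on it, and vanishes on `R`. -/
def IsCompletelyReducible {k : ℕ} (T : M k →ₗ[ℂ] M k) : Prop :=
  IsPositiveMap T ∧ IsSelfAdjointMap T ∧
  ∃ (l : ℕ) (W : Fin l → M k),
    (∀ i, IsStarProjection (W i)) ∧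
    (∀ i j, i ≠ j → W i * W j = 0) ∧
    iSupIndep (fun i => corner (W i)) ∧
    IsCompl (⨆ i, corner (W i)) (traceOrthogonal (⨆ i, corner (W i))) ∧
    (∀ i, LeavesInvariant T (W i)) ∧
    (∀ i, IsIrreducibleOn T (W i)) ∧
    (∀ X ∈ traceOrthogonal (⨆ i, corner (W i)), T X = 0)

/-- The set `CR_{k,m}` of completely reducible states: the positive semidefinite
`γ ∈ M_k ⊗ M_m` for which `F_γ ∘ G_γ : M_k → M_k` is completely reducible. -/
def CR (k m : ℕ) : Set (M₂ k m) :=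
  {γ | γ.PosSemidef ∧ IsCompletelyReducible (mapF γ ∘ₗ mapG γ)}

end CompletelyReducible

namespace CompletelyReducible

open Matrix

/-! Let `T = F ∘ G`. If `T` preserves the corner of a projection `W`, duality of `F` and `G` gives
`tr(G(1-W) G(W)) = 0`, so these positive matrices have product zero. Positivity of `γ` puts the
kernel of `G(V)` inside that of `G(V X)`; positivity of the partial transpose gives the same for
left annihilators. Together they force `G`, hence `T`, to vanish on the off-diagonal blocks of `W`
(`killsOffDiagonal_mapF_comp_mapG`). The rest uses only this and self-adjointness: the complement of
an invariant corner is again invariant (`leavesInvariant_sub`), so `1` splits into irreducible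
projections, and everything off their diagonal blocks is killed. -/

open scoped MatrixOrder Matrix.Norms.L2Operator in
theorem exists_eq_conjTranspose_mul_self {k : ℕ} {P : M k} (hP : P.PosSemidef) :
    ∃ C : M k, P = Cᴴ * C :=
  CStarAlgebra.nonneg_iff_eq_star_mul_self.mp hP.nonneg

/-! ### Positivity and duality of `G` and `F` -/

/-- Each row of `C` contributes the form of `γ` at a product vector. For `γ ≥ 0` the terms are
nonnegative, so a zero total makes every term zero. -/
theorem quadraticForm_mapG {k m : ℕ} (γ : M₂ k m) (C : M k) (v : Fin m → ℂ) :
    star v ⬝ᵥ (mapG γ (Cᴴ * C) *ᵥ v) =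
      ∑ c, star (fun p : Fin k × Fin m => star (C c p.1) * v p.2) ⬝ᵥ
        (γ *ᵥ fun p => star (C c p.1) * v p.2) := by
  simp only [dotProduct, mulVec, mapG, LinearMap.coe_mk, AddHom.coe_mk, of_apply, mul_apply,
    Finset.mul_sum, Finset.sum_mul, Fintype.sum_prod_type, Pi.star_apply, conjTranspose_apply,
    star_mul', star_star]
  have h : ∀ f : Fin m → Fin m → Fin k → Fin k → Fin k → ℂ,
      ∑ j, ∑ j', ∑ a, ∑ a', ∑ c, f j j' a a' c = ∑ c, ∑ a, ∑ j, ∑ a', ∑ j', f j j' a a' c := by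
    intro f
    simp only [Finset.sum_comm (s := (Finset.univ : Finset (Fin m)))
      (t := (Finset.univ : Finset (Fin k)))]
    conv_rhs => rw [Finset.sum_comm]
    refine Finset.sum_congr rfl fun a _ => ?_
    rw [Finset.sum_comm]
  rw [h]
  refine Finset.sum_congr rfl fun c _ => Finset.sum_congr rfl fun a _ =>
    Finset.sum_congr rfl fun j _ => Finset.sum_congr rfl fun a' _ =>
    Finset.sum_congr rfl fun j' _ => by ring

theorem trace_mapG_mul {k m : ℕ} (γ : M₂ k m) (X : M k) (Y : M m) :
    (mapG γ X * Y).trace = (X * mapF γ Y).trace := by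
  simp only [trace, diag_apply, mul_apply, mapG, mapF, LinearMap.coe_mk, AddHom.coe_mk, of_apply,
    Finset.mul_sum, Finset.sum_mul]
  have h : ∀ f : Fin m → Fin m → Fin k → Fin k → ℂ,
      ∑ j, ∑ j', ∑ a, ∑ a', f j j' a a' = ∑ a', ∑ a, ∑ j, ∑ j', f j j' a a' := by
    intro f
    simp only [Finset.sum_comm (s := (Finset.univ : Finset (Fin m)))
      (t := (Finset.univ : Finset (Fin k)))]
    exact Finset.sum_comm
  rw [h]
  exact Finset.sum_congr rfl fun a _ => Finset.sum_congr rfl fun j _ =>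
    Finset.sum_congr rfl fun a' _ => Finset.sum_congr rfl fun j' _ => by ring

theorem mapF_eq_mapG_swap {k m : ℕ} (γ : M₂ k m) (Y : M m) :
    mapF γ Y = mapG (γ.submatrix Prod.swap Prod.swap : M₂ m k) Y := rfl

theorem mapG_partialTranspose {k m : ℕ} (γ : M₂ k m) (X : M k) :
    mapG (partialTranspose γ) X = (mapG γ X)ᵀ := rfl

theorem conjTranspose_mapG {k m : ℕ} {γ : M₂ k m} (hγ : γ.IsHermitian) (X : M k) :
    (mapG γ X)ᴴ = mapG γ Xᴴ := by
  ext j j'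
  simp only [mapG, LinearMap.coe_mk, AddHom.coe_mk, of_apply, conjTranspose_apply, star_sum,
    star_mul']
  rw [Finset.sum_comm]
  exact Finset.sum_congr rfl fun a _ => Finset.sum_congr rfl fun a' _ => by rw [hγ.apply]

theorem conjTranspose_mapF {k m : ℕ} {γ : M₂ k m} (hγ : γ.IsHermitian) (Y : M m) :
    (mapF γ Y)ᴴ = mapF γ Yᴴ := by
  rw [mapF_eq_mapG_swap, conjTranspose_mapG (hγ.submatrix _), mapF_eq_mapG_swap]

theorem posSemidef_mapG {k m : ℕ} {γ : M₂ k m} (hγ : γ.PosSemidef) {X : M k}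
    (hX : X.PosSemidef) : (mapG γ X).PosSemidef := by
  obtain ⟨C, rfl⟩ := exists_eq_conjTranspose_mul_self hX
  refine .of_dotProduct_mulVec_nonneg ?_ fun v => ?_
  · rw [IsHermitian, conjTranspose_mapG hγ.isHermitian, hX.isHermitian]
  · rw [quadraticForm_mapG]
    exact Finset.sum_nonneg fun c _ => hγ.dotProduct_mulVec_nonneg _

theorem posSemidef_mapF {k m : ℕ} {γ : M₂ k m} (hγ : γ.PosSemidef) {Y : M m}
    (hY : Y.PosSemidef) : (mapF γ Y).PosSemidef :=
  posSemidef_mapG (hγ.submatrix Prod.swap) hY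

theorem isPositiveMap_mapF_comp_mapG {k m : ℕ} {γ : M₂ k m} (hγ : γ.PosSemidef) :
    IsPositiveMap (mapF γ ∘ₗ mapG γ) :=
  fun _ hX => posSemidef_mapF hγ (posSemidef_mapG hγ hX)

theorem isSelfAdjointMap_mapF_comp_mapG {k m : ℕ} {γ : M₂ k m} (hγ : γ.IsHermitian) :
    IsSelfAdjointMap (mapF γ ∘ₗ mapG γ) := by
  intro X Y
  rw [LinearMap.comp_apply, LinearMap.comp_apply, conjTranspose_mapF hγ, conjTranspose_mapG hγ,
    ← trace_mapG_mul, trace_mul_comm, ← trace_mapG_mul, trace_mul_comm]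

/-! ### Vanishing on off-diagonal blocks -/

theorem conjTranspose_of_isStarProjection {k : ℕ} {W : M k} (hW : IsStarProjection W) :
    Wᴴ = W := hW.isSelfAdjoint

theorem mul_self_of_isStarProjection {k : ℕ} {W : M k} (hW : IsStarProjection W) :
    W * W = W := hW.isIdempotentElem

theorem posSemidef_of_isStarProjection {k : ℕ} {W : M k} (hW : IsStarProjection W) :
    W.PosSemidef := by
  have h := posSemidef_conjTranspose_mul_self W
  rwa [conjTranspose_of_isStarProjection hW, mul_self_of_isStarProjection hW] at h

theorem mapG_mul_mulVec_eq_zero {k m : ℕ} {γ : M₂ k m} (hγ : γ.PosSemidef) {W : M k}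
    (hW : IsStarProjection W) (X : M k) {v : Fin m → ℂ} (hv : mapG γ W *ᵥ v = 0) :
    mapG γ (W * X) *ᵥ v = 0 := by
  have hq := quadraticForm_mapG γ W v
  rw [conjTranspose_of_isStarProjection hW, mul_self_of_isStarProjection hW, hv,
    dotProduct_zero, eq_comm,
    Finset.sum_eq_zero_iff_of_nonneg fun c _ => hγ.dotProduct_mulVec_nonneg _] at hq
  -- A zero of a positive semidefinite form is a kernel vector: `γ` kills (column `c` of `W`) ⊗ `v`.
  -- The target is a combination of these with coefficients from `X`.
  have hker : ∀ c p, ∑ q : Fin k × Fin m, γ p q * (W q.1 c * v q.2) = 0 := by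
    intro c p
    have h := congrFun ((hγ.dotProduct_mulVec_zero_iff _).mp (hq c (Finset.mem_univ c))) p
    have hs : ∀ a, star (W c a) = W a c := fun a =>
      congrFun (congrFun (conjTranspose_of_isStarProjection hW) a) c
    simpa only [mulVec, dotProduct, hs, Pi.zero_apply] using h
  ext j
  have h0 : ∑ a, ∑ c, X c a * ∑ q : Fin k × Fin m, γ (a, j) q * (W q.1 c * v q.2) = 0 := by
    simp only [hker, mul_zero, Finset.sum_const_zero]
  rw [Pi.zero_apply, ← h0]
  simp only [dotProduct, mulVec, mapG, LinearMap.coe_mk, AddHom.coe_mk, of_apply, mul_apply,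
    Finset.mul_sum, Finset.sum_mul, Fintype.sum_prod_type]
  have h : ∀ f : Fin m → Fin k → Fin k → Fin k → ℂ,
      ∑ j', ∑ a, ∑ a', ∑ c, f j' a a' c = ∑ a, ∑ c, ∑ a', ∑ j', f j' a a' c := by
    intro f
    rw [Finset.sum_comm]
    refine Finset.sum_congr rfl fun a _ => ?_
    rw [Finset.sum_comm]
    simp only [Finset.sum_comm (s := (Finset.univ : Finset (Fin m)))]
    rw [Finset.sum_comm]
  rw [h]
  exact Finset.sum_congr rfl fun a _ => Finset.sum_congr rfl fun j _ =>
    Finset.sum_congr rfl fun a' _ => Finset.sum_congr rfl fun j' _ => by ring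

theorem mapG_mul_mul_eq_zero {k m : ℕ} {γ : M₂ k m} (hγ : γ.PosSemidef) {W : M k}
    (hW : IsStarProjection W) (X : M k) {N : M m} (hN : mapG γ W * N = 0) :
    mapG γ (W * X) * N = 0 := by
  ext i j
  exact congrFun (mapG_mul_mulVec_eq_zero hγ hW X (v := fun l => N l j)
    (funext fun i => congrFun (congrFun hN i) j)) i

/-- Partial transposition of `γ` transposes the values of `G`, exchanging left and right
annihilators. -/
theorem mul_mapG_mul_eq_zero {k m : ℕ} {γ : M₂ k m} (hγ : (partialTranspose γ).PosSemidef)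
    {W : M k} (hW : IsStarProjection W) (X : M k) {N : M m} (hN : N * mapG γ W = 0) :
    N * mapG γ (W * X) = 0 := by
  rw [← transpose_eq_zero, transpose_mul, ← mapG_partialTranspose] at hN ⊢
  exact mapG_mul_mul_eq_zero hγ hW X hN

/-- With `Z = G(W X V)`, the left version gives `G(V) Z = 0`; the right version then gives `G(V Xᴴ
W) Z = Zᴴ Z = 0`. -/
theorem mapG_mul_mul_eq_zero_of_mul_eq_zero {k m : ℕ} {γ : M₂ k m} (hγ : γ.PosSemidef)
    (hγΓ : (partialTranspose γ).PosSemidef) {V W : M k} (hV : IsStarProjection V)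
    (hW : IsStarProjection W) (hVW : mapG γ V * mapG γ W = 0) (X : M k) :
    mapG γ (W * X * V) = 0 := by
  have h := mapG_mul_mul_eq_zero hγ hV (Xᴴ * W) (mul_mapG_mul_eq_zero hγΓ hW (X * V) hVW)
  rw [← conjTranspose_mul_self_eq_zero, conjTranspose_mapG hγ.isHermitian]
  simpa only [conjTranspose_mul, conjTranspose_of_isStarProjection hV,
    conjTranspose_of_isStarProjection hW, mul_assoc] using h

/-- For `P = Cᴴ C` and `Q = Dᴴ D` the trace is the squared Hilbert–Schmidt norm of `C Dᴴ`. -/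
theorem mul_eq_zero_of_trace_mul_eq_zero {m : ℕ} {P Q : M m} (hP : P.PosSemidef)
    (hQ : Q.PosSemidef) (h : (P * Q).trace = 0) : P * Q = 0 := by
  obtain ⟨C, rfl⟩ := exists_eq_conjTranspose_mul_self hP
  obtain ⟨D, rfl⟩ := exists_eq_conjTranspose_mul_self hQ
  have h' : C * Dᴴ = 0 := by
    rw [← trace_mul_conjTranspose_self_eq_zero_iff, ← h, conjTranspose_mul,
      conjTranspose_conjTranspose, mul_assoc Cᴴ, trace_mul_comm Cᴴ]
    simp only [mul_assoc]
  rw [mul_assoc, ← mul_assoc C, h', zero_mul, mul_zero]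

/-- Multiplying by `W` on either side fixes the elements of `W M_k W`. -/
theorem mem_corner_iff {k : ℕ} {W : M k} (hW : IsStarProjection W) (Y : M k) :
    Y ∈ corner W ↔ W * Y = Y ∧ Y * W = Y := by
  have hWW := mul_self_of_isStarProjection hW
  rw [mem_corner]
  constructor
  · rintro ⟨X, rfl⟩
    exact ⟨by rw [← mul_assoc, ← mul_assoc, hWW], by rw [mul_assoc, hWW]⟩
  · rintro ⟨h₁, h₂⟩
    exact ⟨Y, by rw [h₁, h₂]⟩

theorem self_mem_corner {k : ℕ} {W : M k} (hW : IsStarProjection W) : W ∈ corner W :=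
  (mem_corner_iff hW W).mpr ⟨mul_self_of_isStarProjection hW, mul_self_of_isStarProjection hW⟩

/-- `T` vanishes on the off-diagonal blocks of every orthogonal projection `W` such that `T` leaves
`W M_k W` invariant. -/
def KillsOffDiagonal {k : ℕ} (T : M k →ₗ[ℂ] M k) : Prop :=
  ∀ W : M k, IsStarProjection W → LeavesInvariant T W →
    ∀ X, T (W * X * (1 - W)) = 0 ∧ T ((1 - W) * X * W) = 0

theorem killsOffDiagonal_mapF_comp_mapG {k m : ℕ} {γ : M₂ k m} (hγ : γ.PosSemidef)
    (hγΓ : (partialTranspose γ).PosSemidef) : KillsOffDiagonal (mapF γ ∘ₗ mapG γ) := by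
  intro W hW hT X
  have hW' : IsStarProjection (1 - W) := hW.one_sub
  have hPG {V : M k} (hV : IsStarProjection V) : (mapG γ V).PosSemidef :=
    posSemidef_mapG hγ (posSemidef_of_isStarProjection hV)
  have htr : (mapG γ (1 - W) * mapG γ W).trace = 0 := by
    have h := ((mem_corner_iff hW _).mp (hT W (self_mem_corner hW))).1
    rw [LinearMap.comp_apply] at h
    rw [trace_mapG_mul, sub_mul, one_mul, h, sub_self, trace_zero]
  have h₁ := mul_eq_zero_of_trace_mul_eq_zero (hPG hW') (hPG hW) htr
  have h₂ := mul_eq_zero_of_trace_mul_eq_zero (hPG hW) (hPG hW') (by rwa [trace_mul_comm])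
  rw [LinearMap.comp_apply, LinearMap.comp_apply,
    mapG_mul_mul_eq_zero_of_mul_eq_zero hγ hγΓ hW' hW h₁,
    mapG_mul_mul_eq_zero_of_mul_eq_zero hγ hγΓ hW hW' h₂, map_zero]
  exact ⟨rfl, rfl⟩

/-! ### Splitting into irreducible corners -/

theorem isStarProjection_sub {k : ℕ} {V W : M k} (hV : IsStarProjection V)
    (hW : IsStarProjection W) (hVW : V * W = W) (hWV : W * V = W) :
    IsStarProjection (V - W) where
  isIdempotentElem := by
    rw [IsIdempotentElem, sub_mul, mul_sub, mul_sub, hVW, hWV, mul_self_of_isStarProjection hV,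
      mul_self_of_isStarProjection hW, sub_self, sub_zero]
  isSelfAdjoint := hV.isSelfAdjoint.sub hW.isSelfAdjoint

/-- It suffices that `W T(X) = 0 = T(X) W`. By self-adjointness `‖W T(X)‖² = ⟨X, T(W T(X))⟩`;
off-diagonal vanishing moves `T(W T(X))` into the corner of `W`, which is orthogonal to `X`. -/
theorem leavesInvariant_sub {k : ℕ} {T : M k →ₗ[ℂ] M k} (hsa : IsSelfAdjointMap T)
    (hT : KillsOffDiagonal T) {V W : M k} (hV : IsStarProjection V) (hW : IsStarProjection W)
    (hVW : V * W = W) (hWV : W * V = W) (hTV : LeavesInvariant T V) (hTW : LeavesInvariant T W) :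
    LeavesInvariant T (V - W) := by
  have hD := isStarProjection_sub hV hW hVW hWV
  have hWW := mul_self_of_isStarProjection hW
  have hWs := conjTranspose_of_isStarProjection hW
  intro X hX
  obtain ⟨hX₁, hX₂⟩ := (mem_corner_iff hD X).mp hX
  have hWX : W * X = 0 := by rw [← hX₁, ← mul_assoc, mul_sub, hWV, hWW, sub_self, zero_mul]
  have hXW : X * W = 0 := by rw [← hX₂, mul_assoc, sub_mul, hVW, hWW, sub_self, mul_zero]
  have hXV : X ∈ corner V := by
    refine (mem_corner_iff hV X).mpr ⟨?_, ?_⟩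
    · rwa [sub_mul, hWX, sub_zero] at hX₁
    · rwa [mul_sub, hXW, sub_zero] at hX₂
  obtain ⟨hTX₁, hTX₂⟩ := (mem_corner_iff hV _).mp (hTV X hXV)
  have horth : ∀ Y ∈ corner W, (X * (T Y)ᴴ).trace = 0 := by
    intro Y hY
    have h := ((mem_corner_iff hW _).mp (hTW Y hY)).2
    rw [← h, conjTranspose_mul, hWs, ← mul_assoc, hXW, zero_mul, trace_zero]
  have hmem : ∀ Z, W * Z * W ∈ corner W := fun Z => (mem_corner _ _).mpr ⟨Z, rfl⟩
  have hl : W * T X = 0 := by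
    have hdec : T (W * T X) = T (W * T X * W) := by
      rw [← sub_eq_zero, ← map_sub, ← (hT W hW hTW (T X)).1, mul_sub, mul_one]
    have h := hsa X (W * T X)
    rw [hdec, horth _ (hmem _), conjTranspose_mul, hWs, ← mul_assoc, trace_mul_comm,
      ← hWW, mul_assoc, ← trace_mul_comm] at h
    rw [← trace_mul_conjTranspose_self_eq_zero_iff, conjTranspose_mul, hWs, ← h]
    simp only [mul_assoc]
  have hr : T X * W = 0 := by
    have hdec : T (T X * W) = T (W * T X * W) := by
      rw [← sub_eq_zero, ← map_sub, ← (hT W hW hTW (T X)).2, sub_mul, sub_mul, one_mul]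
    have h := hsa X (T X * W)
    rw [hdec, horth _ (hmem _), conjTranspose_mul, hWs] at h
    rw [← trace_mul_conjTranspose_self_eq_zero_iff, conjTranspose_mul, hWs, ← h, mul_assoc,
      ← mul_assoc W, hWW]
  refine (mem_corner_iff hD _).mpr ⟨?_, ?_⟩
  · rw [sub_mul, hTX₁, hl, sub_zero]
  · rw [mul_sub, hTX₂, hr, sub_zero]

/-- Induction on the dimension of the corner: a reducing `W` splits `V` into `W` and `V - W`, both
with strictly smaller corners. -/
theorem exists_irreducible_decomposition {k : ℕ} {T : M k →ₗ[ℂ] M k} (hsa : IsSelfAdjointMap T)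
    (hT : KillsOffDiagonal T) (V : M k) (hV : IsStarProjection V) (hTV : LeavesInvariant T V) :
    ∃ (ι : Type) (_ : Fintype ι) (W : ι → M k), (∀ i, IsStarProjection (W i)) ∧
      (∀ i j, i ≠ j → W i * W j = 0) ∧ ∑ i, W i = V ∧ (∀ i, LeavesInvariant T (W i)) ∧
      ∀ i, IsIrreducibleOn T (W i) := by
  induction hn : Module.finrank ℂ (corner V) using Nat.strong_induction_on generalizing V with
  | _ n ih =>
  by_cases hirr : IsIrreducibleOn T V
  · exact ⟨Unit, inferInstance, fun _ => V, fun _ => hV, fun i j h => (h rfl).elim, by simp,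
      fun _ => hTV, fun _ => hirr⟩
  simp only [IsIrreducibleOn, not_forall, not_or] at hirr
  obtain ⟨W, hW, hle, hTW, hW0, hWneV⟩ := hirr
  obtain ⟨hVW, hWV⟩ := (mem_corner_iff hV W).mp (hle (self_mem_corner hW))
  have hD := isStarProjection_sub hV hW hVW hWV
  have hVV := mul_self_of_isStarProjection hV
  have hWW := mul_self_of_isStarProjection hW
  have hlt : ∀ U : M k, IsStarProjection U → V * U = U → U * V = U → U ≠ V →
      Module.finrank ℂ (corner U) < n := by
    intro U hU hVU hUV hne
    rw [← hn]
    refine Submodule.finrank_lt_finrank_of_lt (lt_of_le_of_ne (fun Y hY => ?_) fun h => hne ?_)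
    · obtain ⟨h₁, h₂⟩ := (mem_corner_iff hU Y).mp hY
      refine (mem_corner_iff hV Y).mpr ⟨?_, ?_⟩
      · rw [← h₁, ← mul_assoc, hVU]
      · rw [← h₂, mul_assoc, hUV]
    · have hm : V ∈ corner U := h ▸ self_mem_corner hV
      rw [← hUV, ((mem_corner_iff hU V).mp hm).1]
  obtain ⟨ι, _, A, hA, hAo, hAs, hAT, hAi⟩ := ih _ (hlt W hW hVW hWV hWneV) W hW hTW rfl
  obtain ⟨κ, _, B, hB, hBo, hBs, hBT, hBi⟩ := ih _
    (hlt (V - W) hD (by rw [mul_sub, hVV, hVW]) (by rw [sub_mul, hVV, hWV])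
      (by rwa [ne_eq, sub_eq_self])) (V - W) hD
    (leavesInvariant_sub hsa hT hV hW hVW hWV hTV hTW) rfl
  classical
  have hAW : ∀ i, A i * W = A i := fun i => by
    rw [← hAs, Finset.mul_sum, Finset.sum_eq_single i (fun j _ h => hAo i j h.symm) (by simp),
      mul_self_of_isStarProjection (hA i)]
  have hWB : ∀ j, W * B j = 0 := fun j => by
    have h : (V - W) * B j = B j := by
      rw [← hBs, Finset.sum_mul, Finset.sum_eq_single j (fun i _ h => hBo i j h) (by simp),
        mul_self_of_isStarProjection (hB j)]
    rw [← h, ← mul_assoc, mul_sub, hWV, hWW, sub_self, zero_mul]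
  have hAB : ∀ i j, A i * B j = 0 := fun i j => by rw [← hAW, mul_assoc, hWB, mul_zero]
  have hBA : ∀ i j, B j * A i = 0 := fun i j => by
    rw [← conjTranspose_eq_zero, conjTranspose_mul, conjTranspose_of_isStarProjection (hA i),
      conjTranspose_of_isStarProjection (hB j), hAB]
  refine ⟨ι ⊕ κ, inferInstance, Sum.elim A B, ?_, ?_, ?_, ?_, ?_⟩
  · rintro (i | j)
    exacts [hA i, hB j]
  · rintro (i | i) (j | j) h
    exacts [hAo i j fun e => h (e ▸ rfl), hAB i j, hBA j i, hBo i j fun e => h (e ▸ rfl)]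
  · simp [hAs, hBs]
  · rintro (i | j)
    exacts [hAT i, hBT j]
  · rintro (i | j)
    exacts [hAi i, hBi j]

/-! ### Block decomposition of the matrix algebra -/

theorem mem_traceOrthogonal_iSup_corner {k : ℕ} {ι : Type*} {W : ι → M k}
    (hW : ∀ i, IsStarProjection (W i)) (X : M k) :
    X ∈ traceOrthogonal (⨆ i, corner (W i)) ↔ ∀ i, W i * X * W i = 0 := by
  constructor
  · intro h i
    have hi := h _ (Submodule.mem_iSup_of_mem i ((mem_corner _ _).mpr ⟨X, rfl⟩))
    rw [← trace_mul_conjTranspose_self_eq_zero_iff, ← hi]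
    have hWW := mul_self_of_isStarProjection (hW i)
    simp only [conjTranspose_mul, conjTranspose_of_isStarProjection (hW i), mul_assoc]
    rw [trace_mul_comm]
    simp only [mul_assoc, hWW]
    rw [← mul_assoc (W i) (W i), hWW]
  · intro h Y hY
    induction hY using Submodule.iSup_induction' with
    | mem i Y hY =>
      obtain ⟨Z, rfl⟩ := (mem_corner _ _).mp hY
      rw [conjTranspose_mul, conjTranspose_mul, conjTranspose_of_isStarProjection (hW i),
        ← mul_assoc, ← mul_assoc, trace_mul_comm, ← mul_assoc, ← mul_assoc, h i, zero_mul,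
        trace_zero]
    | zero => simp
    | add Y Z _ _ hY hZ => rw [conjTranspose_add, mul_add, trace_add, hY, hZ, add_zero]

theorem corner_mul_mul_eq_zero {k : ℕ} {U W : M k} (hUW : U * W = 0) {Y : M k}
    (hY : Y ∈ corner W) : U * Y * U = 0 := by
  obtain ⟨Z, rfl⟩ := (mem_corner _ _).mp hY
  rw [← mul_assoc, ← mul_assoc, hUW, zero_mul, zero_mul, zero_mul]

/-- Compression by `W i` fixes its own corner and kills the others. -/
theorem iSupIndep_corner {k : ℕ} {ι : Type*} {W : ι → M k} (hW : ∀ i, IsStarProjection (W i))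
    (ho : ∀ i j, i ≠ j → W i * W j = 0) : iSupIndep fun i => corner (W i) := by
  intro i
  rw [Submodule.disjoint_def]
  intro Y hY hY'
  have hle : ⨆ j, ⨆ _ : j ≠ i, corner (W j) ≤
      LinearMap.ker (LinearMap.mulLeftRight ℂ (W i, W i)) :=
    iSup₂_le fun j hj Z hZ => by
      rw [LinearMap.mem_ker, LinearMap.mulLeftRight_apply]
      exact corner_mul_mul_eq_zero (ho i j hj.symm) hZ
  have h := hle hY'
  obtain ⟨h₁, h₂⟩ := (mem_corner_iff (hW i) Y).mp hY
  rwa [LinearMap.mem_ker, LinearMap.mulLeftRight_apply, h₁, h₂] at h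

theorem isCompl_traceOrthogonal_iSup_corner {k : ℕ} {ι : Type*} [Fintype ι] {W : ι → M k}
    (hW : ∀ i, IsStarProjection (W i)) (ho : ∀ i j, i ≠ j → W i * W j = 0) :
    IsCompl (⨆ i, corner (W i)) (traceOrthogonal (⨆ i, corner (W i))) := by
  classical
  constructor
  · rw [Submodule.disjoint_def]
    intro X hX hX'
    rw [← trace_mul_conjTranspose_self_eq_zero_iff]
    exact hX' X hX
  · rw [Submodule.codisjoint_iff_exists_add_eq]
    intro X
    have hc : ∀ i, W i * X * W i ∈ corner (W i) := fun i => (mem_corner _ _).mpr ⟨X, rfl⟩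
    refine ⟨∑ i, W i * X * W i, X - ∑ i, W i * X * W i,
      Submodule.sum_mem _ fun i _ => Submodule.mem_iSup_of_mem i (hc i), ?_, by abel⟩
    rw [mem_traceOrthogonal_iSup_corner hW]
    intro i
    obtain ⟨h₁, h₂⟩ := (mem_corner_iff (hW i) _).mp (hc i)
    rw [mul_sub, sub_mul, Finset.mul_sum, Finset.sum_mul, Finset.sum_eq_single i
      (fun j _ h => corner_mul_mul_eq_zero (ho i j h.symm) (hc j)) (by simp), h₁, h₂, sub_self]

theorem isCompletelyReducible_of_killsOffDiagonal {k : ℕ} {T : M k →ₗ[ℂ] M k}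
    (hpos : IsPositiveMap T) (hsa : IsSelfAdjointMap T) (hT : KillsOffDiagonal T) :
    IsCompletelyReducible T := by
  obtain ⟨ι, _, W, hW, ho, hsum, hTW, hirr⟩ := exists_irreducible_decomposition hsa hT 1 (.one _)
    fun X _ => (mem_corner_iff (.one _) _).mpr ⟨one_mul _, mul_one _⟩
  let e := (Fintype.equivFin ι).symm
  have hoe : ∀ i j, i ≠ j → W (e i) * W (e j) = 0 := fun i j h => ho _ _ (e.injective.ne h)
  refine ⟨hpos, hsa, Fintype.card ι, fun i => W (e i), fun i => hW _, hoe,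
    iSupIndep_corner (fun i => hW _) hoe, isCompl_traceOrthogonal_iSup_corner (fun i => hW _) hoe,
    fun i => hTW _, fun i => hirr _, fun X hX => ?_⟩
  rw [mem_traceOrthogonal_iSup_corner fun i => hW _] at hX
  have hdec : X = ∑ i, ∑ j, W i * X * W j := by
    simp only [← Finset.mul_sum, ← Finset.sum_mul, hsum, one_mul, mul_one]
  rw [hdec, map_sum]
  refine Finset.sum_eq_zero fun i _ => ?_
  rw [map_sum]
  refine Finset.sum_eq_zero fun j _ => ?_
  by_cases hij : i = j
  · obtain ⟨i, rfl⟩ := e.surjective i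
    rw [← hij, hX i, map_zero]
  -- Since `W j * W i = 0`, the block `W i * X * W j` equals `W i * (X * W j) * (1 - W i)`.
  · have h := (hT _ (hW i) (hTW i) (X * W j)).1
    rwa [mul_sub, mul_one, mul_assoc (W i) (X * W j), mul_assoc X, ho j i (Ne.symm hij), mul_zero,
      mul_zero, sub_zero, ← mul_assoc] at h

end CompletelyReducible

theorem mainTheorem12 (k m : ℕ) (γ : CompletelyReducible.M₂ k m)
    (hγ : γ.PosSemidef) (hγΓ : (CompletelyReducible.partialTranspose γ).PosSemidef) :
    γ ∈ CompletelyReducible.CR k m :=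
  ⟨hγ, CompletelyReducible.isCompletelyReducible_of_killsOffDiagonal
    (CompletelyReducible.isPositiveMap_mapF_comp_mapG hγ)
    (CompletelyReducible.isSelfAdjointMap_mapF_comp_mapG hγ.isHermitian)
    (CompletelyReducible.killsOffDiagonal_mapF_comp_mapG hγ hγΓ)⟩
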